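/- Let $\mathbb S=\mathbb R/2\pi\mathbb Z$ with Lebesgue measure (total mass $2\pi$), and consider real-valued functions. For $G\in L_\infty(\mathbb S)$ put $\langle G\rangle=\frac1{2\pi}\int_0^{2\pi}G(x)\,dx$. Define the limit reachable set \[ D_\infty=\Big\{(F,f)\in L_\infty(\mathbb S)\times\mathbb R\ \Big|\ \forall(\Phi,\phi)\in L_1(\mathbb S)\times\mathbb R:\ \int_0^{2\pi}F(x)\Phi(x)\,dx+2\pi f\phi\le\frac1{2\pi}\int_0^1\!\int_0^{2\pi}|\Phi(x)-\phi\tau|\,dx\,d\tau\Big\}, \] its Minkowski function $\mu_{D_\infty}(F,f)=\inf\{r>0:(F,f)\in rD_\infty\}$, and its support function on $L_\infty^*(\mathbb S)\times\mathbb R$, \[ s_{D_\infty}(\Phi,\phi)=\sup_{(G,g)\in D_\infty}\big(\langle G,\Phi\rangle+2\pi g\phi\big), \] where $\langle\cdot,\cdot\rangle$ is the duality pairing of $L_\infty(\mathbb S)$ with its Banach dual $L_\infty^*(\mathbb S)$. Theorem. For every $(F,f)\in L_\infty(\mathbb S)\times\mathbb R$, \[ \mu_{D_\infty}(F,f)=2\pi\max\Big\{\|F\|_{L_\infty(\mathbb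 S)},\ \big|\langle F\rangle+2f\big|+\sqrt{(\langle F\rangle+2f)^2+\langle F^2\rangle}\Big\}. \] If $\mu:=\mu_{D_\infty}(F,f)>2\pi\|F\|_{L_\infty(\mathbb S)}$, then there exists a unique pair $(\Phi,\phi)\in L_\infty^*(\mathbb S)\times\mathbb R$ such that \[ \langle F,\Phi\rangle+2\pi f\phi=\mu\qquad\text{and}\qquad s_{D_\infty}(\Phi,\phi)=1 . \] Moreover, in this case \[ \phi=\frac{4\mu^2}{\mu^2+4\pi^2\langle F^2\rangle}\,\mathrm{sign}\big(\langle F\rangle+2f\big), \] and $\Phi$ is the functional $G\mapsto\int_0^{2\pi}G(x)\Phi(x)\,dx$ given by the function \[ \Phi(x)=\frac{\pi}{\mu}|\phi|F(x)+\frac12\phi . \] -/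

import Mathlib

open scoped Real ENNReal

open MeasureTheory

/-- Needed for the measure on `AddCircle (2 * π)`. -/
instance fact_two_pi_pos : Fact ((0 : ℝ) < 2 * π) := ⟨Real.two_pi_pos⟩

/-- The circle `ℝ / 2πℤ`. Its `volume` is Lebesgue measure, of total mass `2π`. -/
abbrev Circle2pi : Type := AddCircle (2 * π)

/-- `L_∞` of the circle, real-valued, with the essential supremum norm. -/
abbrev LInf : Type := Lp ℝ ∞ (volume : Measure Circle2pi)

/-- `L_1` of the circle, real-valued. -/
abbrev LOne : Type := Lp ℝ 1 (volume : Measure Circle2pi)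

/-- The mean value `(1 / 2π) ∫ G` of a function on the circle. -/
noncomputable def circleMean (G : Circle2pi → ℝ) : ℝ :=
  (2 * π)⁻¹ * ∫ x, G x

/-- The limit reachable set `D_∞ ⊆ L_∞ × ℝ`, cut out by all `(Φ, φ) ∈ L_1 × ℝ`. -/
def limitReachableSet : Set (LInf × ℝ) :=
  {p | ∀ (Φ : LOne) (φ : ℝ),
    (∫ x, p.1 x * Φ x) + 2 * π * p.2 * φ ≤
      (2 * π)⁻¹ * ∫ τ in (0 : ℝ)..1, ∫ x, |Φ x - φ * τ|}

/-- The pairing `⟨F, Φ⟩ + 2π f φ` between `L_∞ × ℝ` and `L_∞^* × ℝ`. -/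
noncomputable def dualPairing (p : LInf × ℝ) (q : StrongDual ℝ LInf × ℝ) : ℝ :=
  q.1 p.1 + 2 * π * p.2 * q.2

/-- The support function, on all of `L_∞^* × ℝ`, of a subset of `L_∞ × ℝ`. -/
noncomputable def supportFun (S : Set (LInf × ℝ)) (q : StrongDual ℝ LInf × ℝ) : EReal :=
  ⨆ p ∈ S, ((dualPairing p q : ℝ) : EReal)

/-- The functional `Φ ∈ L_∞^*` is the image of the integrable function `g` under the canonical
embedding `L_1 → L_∞^*`, i.e. `⟨G, Φ⟩ = ∫ G g` for all `G ∈ L_∞`. -/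
def IsRepresentedBy (Φ : StrongDual ℝ LInf) (g : Circle2pi → ℝ) : Prop :=
  Integrable g ∧ ∀ G : LInf, Φ G = ∫ x, G x * g x

/-! ### Integrals of `|Φ - φ τ|` over the unit interval -/

/-! The set `D_∞` is cut out by two inequalities (`mem_limitReachableSet_iff`): `2π‖F‖ ≤ 1` and
`4π|⟨F⟩ + 2f| + 4π²⟨F²⟩ ≤ 1`. They suffice by integrating a pointwise lower bound for `∫ |Φ - φτ|
dτ`; they are necessary by testing with `φ = 0`, and with `φ = ±1`, `Φ = φ/2 + πF`, where that bound
is an equality. Scaling by `1/r` turns the second inequality into a quadratic one in `r`, whose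
larger root gives the square root in `gauge_limitReachableSet`.

If `μ > 2π‖F‖`, then at `(F, f)/μ` only the quadratic constraint is active, and it is smooth there
because `⟨F⟩ + 2f ≠ 0`. The slack in the norm allows small variations in every direction of `L_∞`,
so any supporting functional, even one in `L_∞^*`, is a multiple of the gradient
(`apply_eq_of_dualPairing_le`); normalisation fixes the multiple. Convexity of the constraint makes
that gradient supporting (`exists_supporting_functional`). -/

theorem intervalIntegral_const_sub_mul (Φ φ u v : ℝ) :
    ∫ τ in u..v, (Φ - φ * τ) = Φ * (v - u) - φ * ((v ^ 2 - u ^ 2) / 2) := by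
  have h : IntervalIntegrable (fun τ => φ * τ) volume u v :=
    (by fun_prop : Continuous fun τ : ℝ => φ * τ).intervalIntegrable _ _
  rw [intervalIntegral.integral_sub (by simp) h, intervalIntegral.integral_const_mul, integral_id]
  simp [mul_comm]

theorem intervalIntegrable_abs_const_sub_mul (Φ φ u v : ℝ) :
    IntervalIntegrable (fun τ => |Φ - φ * τ|) volume u v :=
  (by fun_prop : Continuous fun τ : ℝ => |Φ - φ * τ|).intervalIntegrable _ _

theorem le_intervalIntegral_abs_const_sub_mul {a : ℝ} (ha : |a| ≤ 1) (Φ φ : ℝ) :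
    a * Φ + φ * ((1 - 2 * a - a ^ 2) / 4) ≤ ∫ τ in (0 : ℝ)..1, |Φ - φ * τ| := by
  obtain ⟨h1, h2⟩ := abs_le.1 ha
  -- The sign pattern `+1` on `[0, s]`, `-1` on `[s, 1]` has mean `a` for this `s`; pairing it with
  -- `Φ - φτ` bounds the integral from below.
  set s : ℝ := (1 + a) / 2 with hs
  have hc : Continuous fun τ : ℝ => Φ - φ * τ := by fun_prop
  have hi := intervalIntegrable_abs_const_sub_mul Φ φ
  rw [← intervalIntegral.integral_add_adjacent_intervals (hi 0 s) (hi s 1)]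
  have e1 : ∫ τ in (0 : ℝ)..s, (Φ - φ * τ) ≤ ∫ τ in (0 : ℝ)..s, |Φ - φ * τ| :=
    intervalIntegral.integral_mono_on (by linarith) (hc.intervalIntegrable _ _) (hi _ _)
      fun τ _ => le_abs_self _
  have e2 : ∫ τ in s..1, -(Φ - φ * τ) ≤ ∫ τ in s..1, |Φ - φ * τ| :=
    intervalIntegral.integral_mono_on (by linarith) (hc.neg.intervalIntegrable _ _) (hi _ _)
      fun τ _ => neg_le_abs _
  rw [intervalIntegral.integral_neg] at e2
  rw [intervalIntegral_const_sub_mul] at e1 e2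
  refine le_trans (le_of_eq ?_) (add_le_add e1 e2)
  rw [hs]; ring

theorem intervalIntegral_abs_sub {s : ℝ} (h0 : 0 ≤ s) (h1 : s ≤ 1) :
    ∫ τ in (0 : ℝ)..1, |s - τ| = s ^ 2 - s + 1 / 2 := by
  have hi : ∀ u v, IntervalIntegrable (fun τ => |s - τ|) volume u v := fun u v =>
    (by fun_prop : Continuous fun τ : ℝ => |s - τ|).intervalIntegrable _ _
  have key : ∀ u v, ∫ τ in u..v, (s - τ) = s * (v - u) - (v ^ 2 - u ^ 2) / 2 := fun u v => by
    simpa using intervalIntegral_const_sub_mul s 1 u v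
  rw [← intervalIntegral.integral_add_adjacent_intervals (hi 0 s) (hi s 1)]
  have e1 : ∫ τ in (0 : ℝ)..s, |s - τ| = ∫ τ in (0 : ℝ)..s, (s - τ) :=
    intervalIntegral.integral_congr fun τ hτ => by
      rw [Set.uIcc_of_le h0] at hτ
      exact abs_of_nonneg (by linarith [hτ.2])
  have e2 : ∫ τ in s..1, |s - τ| = ∫ τ in s..1, -(s - τ) :=
    intervalIntegral.integral_congr fun τ hτ => by
      rw [Set.uIcc_of_le h1] at hτ
      exact abs_of_nonpos (by linarith [hτ.1])
  rw [e1, e2, intervalIntegral.integral_neg, key, key]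
  ring

/-! ### Bounded functions on the circle and their means -/

theorem volume_real_univ_circle2pi : (volume : Measure Circle2pi).real Set.univ = 2 * π := by
  rw [measureReal_def, AddCircle.measure_univ, ENNReal.toReal_ofReal Real.two_pi_pos.le]

namespace LInf

theorem ae_abs_le_norm (F : LInf) : ∀ᵐ x, |F x| ≤ ‖F‖ := by
  filter_upwards [ae_le_eLpNormEssSup (f := F) (μ := volume)] with x hx
  rw [Lp.norm_def, eLpNorm_exponent_top, ← Real.norm_eq_abs, ← toReal_enorm]
  refine ENNReal.toReal_mono ?_ hx
  rw [← eLpNorm_exponent_top]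
  exact Lp.eLpNorm_ne_top F

theorem norm_le_of_ae_abs_le {F : LInf} {C : ℝ} (hC : 0 ≤ C) (h : ∀ᵐ x, |F x| ≤ C) : ‖F‖ ≤ C := by
  simpa using Lp.norm_le_of_ae_bound (p := ∞) hC (f := F) h

theorem aestronglyMeasurable (F : LInf) : AEStronglyMeasurable F volume :=
  Lp.aestronglyMeasurable F

theorem integrable_mul (F : LInf) {g : Circle2pi → ℝ} (hg : Integrable g) :
    Integrable fun x => F x * g x :=
  hg.bdd_mul F.aestronglyMeasurable F.ae_abs_le_norm

theorem integrable (F : LInf) : Integrable F :=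
  (Lp.memLp F).integrable le_top

theorem integrable_mul_coe (F G : LInf) : Integrable fun x => F x * G x :=
  F.integrable_mul G.integrable

theorem integrable_sq (F : LInf) : Integrable fun x => F x ^ 2 := by
  simpa only [sq] using F.integrable_mul_coe F

theorem _root_.circleMean_add_const_mul {u v w : Circle2pi → ℝ} (hu : Integrable u)
    (hv : Integrable v) (hw : Integrable w) (a b : ℝ) :
    circleMean (fun x => u x + a * v x + b * w x) =
      circleMean u + a * circleMean v + b * circleMean w := by
  have hav : Integrable fun x => a * v x := hv.const_mul a
  have huv : Integrable fun x => u x + a * v x := hu.add hav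
  simp only [circleMean]
  rw [integral_add huv (hw.const_mul b), integral_add hu hav, integral_const_mul,
    integral_const_mul]
  ring

theorem circleMean_smul (t : ℝ) (F : LInf) :
    circleMean (t • F : LInf) = t * circleMean F := by
  rw [circleMean, circleMean, integral_congr_ae (Lp.coeFn_smul t F)]
  simp only [Pi.smul_apply, smul_eq_mul, integral_const_mul]
  ring

theorem circleMean_add (F G : LInf) :
    circleMean (F + G : LInf) = circleMean F + circleMean G := by
  rw [circleMean, circleMean, circleMean, integral_congr_ae (Lp.coeFn_add F G)]
  simp only [Pi.add_apply, integral_add F.integrable G.integrable]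
  ring

theorem circleMean_sq_smul (t : ℝ) (F : LInf) :
    circleMean (fun x => (t • F : LInf) x ^ 2) = t ^ 2 * circleMean (fun x => F x ^ 2) := by
  have h : (fun x => (t • F : LInf) x ^ 2) =ᵐ[volume] fun x => t ^ 2 * F x ^ 2 := by
    filter_upwards [Lp.coeFn_smul t F] with x hx
    rw [hx]; simp [mul_pow]
  rw [circleMean, circleMean, integral_congr_ae h, integral_const_mul]
  ring

theorem circleMean_smul_mul (t : ℝ) (F G : LInf) :
    circleMean (fun x => (t • F : LInf) x * G x) = t * circleMean (fun x => F x * G x) := by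
  have h : (fun x => (t • F : LInf) x * G x) =ᵐ[volume] fun x => t * (F x * G x) := by
    filter_upwards [Lp.coeFn_smul t F] with x hx
    rw [hx]; simp [mul_assoc]
  rw [circleMean, circleMean, integral_congr_ae h, integral_const_mul]
  ring

theorem circleMean_sq_add_smul (t : ℝ) (F G : LInf) :
    circleMean (fun x => (F + t • G : LInf) x ^ 2) =
      circleMean (fun x => F x ^ 2) + 2 * t * circleMean (fun x => F x * G x) +
        t ^ 2 * circleMean (fun x => G x ^ 2) := by
  have h : (fun x => (F + t • G : LInf) x ^ 2) =ᵐ[volume]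
      fun x => F x ^ 2 + 2 * t * (F x * G x) + t ^ 2 * G x ^ 2 := by
    filter_upwards [Lp.coeFn_add F (t • G), Lp.coeFn_smul t G] with x hx hy
    rw [hx, Pi.add_apply, hy]
    simp only [Pi.smul_apply, smul_eq_mul]
    ring
  rw [circleMean, integral_congr_ae h]
  exact circleMean_add_const_mul F.integrable_sq (F.integrable_mul_coe G) G.integrable_sq _ _

theorem circleMean_sq_nonneg (F : LInf) : 0 ≤ circleMean (fun x => F x ^ 2) :=
  mul_nonneg (by positivity) (integral_nonneg fun _ => sq_nonneg _)

theorem circleMean_sq_le (F : LInf) : circleMean (fun x => F x ^ 2) ≤ ‖F‖ ^ 2 := by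
  have h : ∫ x, F x ^ 2 ≤ ∫ _ : Circle2pi, ‖F‖ ^ 2 := by
    refine integral_mono_ae F.integrable_sq (integrable_const _) ?_
    filter_upwards [F.ae_abs_le_norm] with x hx
    exact sq_le_sq' (neg_le_of_abs_le hx) (le_of_abs_le hx)
  rw [integral_const, volume_real_univ_circle2pi, smul_eq_mul] at h
  rw [circleMean, inv_mul_le_iff₀ Real.two_pi_pos]
  exact h

end LInf

/-! ### Description of the limit reachable set -/

theorem integrable_abs_sub_mul_prod {Φ : Circle2pi → ℝ} (hΦ : Integrable Φ) (φ : ℝ) :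
    Integrable (fun z : Circle2pi × ℝ => |Φ z.1 - φ * z.2|)
      (volume.prod (volume.restrict (Set.Ioc (0 : ℝ) 1))) := by
  have h1 : Integrable (fun τ : ℝ => φ * τ) (volume.restrict (Set.Ioc (0 : ℝ) 1)) :=
    ((by fun_prop : Continuous fun τ : ℝ => φ * τ).intervalIntegrable 0 1).1
  exact ((hΦ.comp_fst _).sub (h1.comp_snd _)).abs

theorem intervalIntegral_integral_abs_sub_mul {Φ : Circle2pi → ℝ} (hΦ : Integrable Φ) (φ : ℝ) :
    ∫ τ in (0 : ℝ)..1, ∫ x, |Φ x - φ * τ| = ∫ x, ∫ τ in (0 : ℝ)..1, |Φ x - φ * τ| := by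
  simp only [intervalIntegral.integral_of_le zero_le_one]
  exact (integral_integral_swap (integrable_abs_sub_mul_prod hΦ φ)).symm

theorem integrable_intervalIntegral_abs_sub_mul {Φ : Circle2pi → ℝ} (hΦ : Integrable Φ) (φ : ℝ) :
    Integrable fun x => ∫ τ in (0 : ℝ)..1, |Φ x - φ * τ| := by
  simp only [intervalIntegral.integral_of_le zero_le_one]
  exact (integrable_abs_sub_mul_prod hΦ φ).integral_prod_left

/-- For `φ < 0` the reversed sign pattern is the better one, which amounts to negating `a`, `Φ` and
`φ` together. -/
theorem le_intervalIntegral_abs_const_sub_mul_abs {a : ℝ} (ha : |a| ≤ 1) (Φ φ : ℝ) :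
    a * Φ + (|φ| * (1 - a ^ 2) - 2 * a * φ) / 4 ≤ ∫ τ in (0 : ℝ)..1, |Φ - φ * τ| := by
  rcases le_total 0 φ with h | h
  · refine le_of_eq_of_le ?_ (le_intervalIntegral_abs_const_sub_mul ha Φ φ)
    rw [abs_of_nonneg h]; ring
  · have e : ∀ τ : ℝ, |Φ - φ * τ| = |-Φ - -φ * τ| := fun τ => by rw [← abs_neg]; congr 1; ring
    simp only [e]
    refine le_of_eq_of_le ?_
      (le_intervalIntegral_abs_const_sub_mul (a := -a) (by rwa [abs_neg]) (-Φ) (-φ))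
    rw [abs_of_nonpos h]; ring

/-- The pointwise bound is used with `a = 2πF(x)`, admissible by the norm constraint, and integrated
over the circle. -/
theorem mem_limitReachableSet_of_le {F : LInf} {f : ℝ} (hF : 2 * π * ‖F‖ ≤ 1)
    (h : 4 * π * |circleMean F + 2 * f| + 4 * π ^ 2 * circleMean (fun x => F x ^ 2) ≤ 1) :
    (F, f) ∈ limitReachableSet := by
  intro Φ φ
  have hΦ : Integrable Φ := L1.integrable_coeFn Φ
  have hFΦ := F.integrable_mul hΦ
  have hae : ∀ᵐ x, 2 * π * (F x * Φ x) +
      (|φ| / 4 - |φ| * π ^ 2 * F x ^ 2 - φ * π * F x) ≤ ∫ τ in (0 : ℝ)..1, |Φ x - φ * τ| := by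
    filter_upwards [F.ae_abs_le_norm] with x hx
    have h1 : |2 * π * F x| ≤ 1 := by
      rw [abs_mul, abs_of_pos Real.two_pi_pos]
      exact (mul_le_mul_of_nonneg_left hx Real.two_pi_pos.le).trans hF
    refine le_of_eq_of_le ?_ (le_intervalIntegral_abs_const_sub_mul_abs h1 (Φ x) φ)
    ring
  have i1 : Integrable fun x => |φ| / 4 - |φ| * π ^ 2 * F x ^ 2 :=
    (integrable_const _).sub (F.integrable_sq.const_mul _)
  have i2 : Integrable fun x => φ * π * F x := F.integrable.const_mul _
  have i3 : Integrable fun x => |φ| / 4 - |φ| * π ^ 2 * F x ^ 2 - φ * π * F x := i1.sub i2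
  have key := integral_mono_ae ((hFΦ.const_mul (2 * π)).add i3)
    (integrable_intervalIntegral_abs_sub_mul hΦ φ) hae
  have e : ∫ x, (2 * π * (F x * Φ x) + (|φ| / 4 - |φ| * π ^ 2 * F x ^ 2 - φ * π * F x)) =
      2 * π * ((∫ x, F x * Φ x) + (|φ| / 4 - |φ| * π ^ 2 * circleMean (fun x => F x ^ 2)
        - φ * π * circleMean F)) := by
    rw [integral_add (hFΦ.const_mul (2 * π)) i3, integral_sub i1 i2,
      integral_sub (integrable_const _) (F.integrable_sq.const_mul _), integral_const,
      integral_const_mul, integral_const_mul, integral_const_mul, volume_real_univ_circle2pi,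
      smul_eq_mul, circleMean, circleMean]
    have := Real.pi_ne_zero
    field_simp
  have key' : 2 * π * ((∫ x, F x * Φ x) + (|φ| / 4 - |φ| * π ^ 2 * circleMean (fun x => F x ^ 2)
        - φ * π * circleMean F)) ≤ ∫ τ in (0 : ℝ)..1, ∫ x, |Φ x - φ * τ| := by
    rw [intervalIntegral_integral_abs_sub_mul hΦ, ← e]
    exact key
  rw [← le_inv_mul_iff₀ Real.two_pi_pos] at key'
  refine le_trans ?_ key'
  have h2 : φ * (circleMean F + 2 * f) ≤ |φ| * |circleMean F + 2 * f| := by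
    rw [← abs_mul]; exact le_abs_self _
  have h3 := mul_le_mul_of_nonneg_left h2 Real.pi_pos.le
  have h4 := mul_le_mul_of_nonneg_left h (abs_nonneg φ)
  change (∫ x, F x * Φ x) + 2 * π * f * φ ≤ _
  linarith

theorem le_of_mem_limitReachableSet {F : LInf} {f : ℝ} (h : (F, f) ∈ limitReachableSet)
    {Φ : Circle2pi → ℝ} (hΦ : Integrable Φ) (φ : ℝ) :
    (∫ x, F x * Φ x) + 2 * π * f * φ ≤
      (2 * π)⁻¹ * ∫ x, ∫ τ in (0 : ℝ)..1, |Φ x - φ * τ| := by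
  have h1 := h (hΦ.toL1 Φ) φ
  rw [intervalIntegral_integral_abs_sub_mul (L1.integrable_coeFn _)] at h1
  have e1 : ∫ x, F x * hΦ.toL1 Φ x = ∫ x, F x * Φ x :=
    integral_congr_ae (hΦ.coeFn_toL1.mono fun x hx => by simp only [hx])
  have e2 : ∫ x, ∫ τ in (0 : ℝ)..1, |hΦ.toL1 Φ x - φ * τ| =
      ∫ x, ∫ τ in (0 : ℝ)..1, |Φ x - φ * τ| :=
    integral_congr_ae (hΦ.coeFn_toL1.mono fun x hx => by simp only [hx])
  rw [e2] at h1
  rw [← e1]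
  exact h1

theorem norm_le_of_mem_limitReachableSet {F : LInf} {f : ℝ} (h : (F, f) ∈ limitReachableSet) :
    2 * π * ‖F‖ ≤ 1 := by
  set k : ℝ := (2 * π)⁻¹ with hk
  have hk0 : 0 < k := inv_pos.2 Real.two_pi_pos
  -- The test function `F (|F| - k)⁺` with `φ = 0` lives where `|F| > k`; its defect `|F| ((|F| -
  -- k)⁺)²` is nonnegative with integral at most zero.
  have hg : Integrable fun x => max (|F x| - k) 0 :=
    (F.integrable.abs.sub (integrable_const k)).pos_part
  have hΦ := F.integrable_mul hg
  have h1 := le_of_mem_limitReachableSet h hΦ 0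
  simp only [mul_zero, add_zero, zero_mul, sub_zero, intervalIntegral.integral_const, one_smul]
    at h1
  have e : ∀ x, F x * (F x * max (|F x| - k) 0) - k * |F x * max (|F x| - k) 0| =
      |F x| * max (|F x| - k) 0 ^ 2 := fun x => by
    rw [abs_mul, abs_of_nonneg (le_max_right (|F x| - k) 0), ← mul_assoc, ← abs_mul_abs_self]
    rcases le_total (|F x| - k) 0 with hx | hx
    · rw [max_eq_right hx]; ring
    · rw [max_eq_left hx]; ring
  have hi : Integrable fun x => |F x| * max (|F x| - k) 0 ^ 2 := by
    simp only [← e]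
    exact (F.integrable_mul hΦ).sub (hΦ.abs.const_mul k)
  have h2 : ∫ x, |F x| * max (|F x| - k) 0 ^ 2 = 0 := by
    refine le_antisymm ?_ (integral_nonneg fun x => by positivity)
    simp only [← e]
    rw [integral_sub (F.integrable_mul hΦ) (hΦ.abs.const_mul k), integral_const_mul]
    linarith
  rw [integral_eq_zero_iff_of_nonneg (fun x => by positivity) hi] at h2
  have h3 : ‖F‖ ≤ k := LInf.norm_le_of_ae_abs_le hk0.le <| h2.mono fun x hx => by
    rcases mul_eq_zero.1 hx with hx | hx
    · rw [hx]; exact hk0.le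
    · linarith [le_max_left (|F x| - k) 0, pow_eq_zero_iff (two_ne_zero) |>.1 hx]
  rwa [hk, ← one_div, le_div_iff₀ Real.two_pi_pos, mul_comm] at h3

theorem signed_le_of_mem_limitReachableSet {F : LInf} {f : ℝ} (h : (F, f) ∈ limitReachableSet)
    {ε : ℝ} (hε : |ε| = 1) :
    4 * π * (ε * (circleMean F + 2 * f)) + 4 * π ^ 2 * circleMean (fun x => F x ^ 2) ≤ 1 := by
  have hε2 : ε * ε = 1 := by rw [← abs_mul_abs_self, hε, one_mul]
  -- With `φ = ε`, the zero of `Φ(x) - ετ` is `τ = (1 + 2πεF(x))/2`, exactly the switching point of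
  -- the optimal sign pattern. The norm constraint places it in `[0, 1]`.
  have hΦ : Integrable fun x => ε / 2 + π * F x :=
    (integrable_const _).add (F.integrable.const_mul π)
  have h1 := le_of_mem_limitReachableSet h hΦ ε
  have e1 : ∫ x, F x * (ε / 2 + π * F x) =
      2 * π * (ε / 2 * circleMean F + π * circleMean (fun x => F x ^ 2)) := by
    have : ∀ x, F x * (ε / 2 + π * F x) = ε / 2 * F x + π * F x ^ 2 := fun x => by ring
    simp only [this]
    rw [integral_add (F.integrable.const_mul _) (F.integrable_sq.const_mul _), integral_const_mul,
      integral_const_mul, circleMean, circleMean]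
    have := Real.pi_ne_zero
    field_simp
  have e2 : ∫ x, ∫ τ in (0 : ℝ)..1, |ε / 2 + π * F x - ε * τ| =
      2 * π * (1 / 4 + π ^ 2 * circleMean (fun x => F x ^ 2)) := by
    have : ∫ x, ∫ τ in (0 : ℝ)..1, |ε / 2 + π * F x - ε * τ| = ∫ x, (1 / 4 + π ^ 2 * F x ^ 2) := by
      refine integral_congr_ae ?_
      filter_upwards [F.ae_abs_le_norm] with x hx
      have hx1 : |ε * (2 * π * F x)| ≤ 1 := by
        rw [abs_mul, hε, one_mul, abs_mul, abs_of_pos Real.two_pi_pos]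
        exact (mul_le_mul_of_nonneg_left hx Real.two_pi_pos.le).trans
          (norm_le_of_mem_limitReachableSet h)
      obtain ⟨hl, hu⟩ := abs_le.1 hx1
      have e : ∀ τ, |ε / 2 + π * F x - ε * τ| = |(1 + ε * (2 * π * F x)) / 2 - τ| := fun τ => by
        have : ε / 2 + π * F x - ε * τ = ε * ((1 + ε * (2 * π * F x)) / 2 - τ) := by
          linear_combination -(π * F x) * hε2
        rw [this, abs_mul, hε, one_mul]
      simp only [e]
      rw [intervalIntegral_abs_sub (by linarith) (by linarith)]
      linear_combination π ^ 2 * F x ^ 2 * hε2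
    rw [this, integral_add (integrable_const _) (F.integrable_sq.const_mul _), integral_const,
      integral_const_mul, volume_real_univ_circle2pi, circleMean, smul_eq_mul]
    have := Real.pi_ne_zero
    field_simp
  rw [e1, e2, inv_mul_cancel_left₀ Real.two_pi_pos.ne'] at h1
  linarith

theorem mem_limitReachableSet_iff {F : LInf} {f : ℝ} :
    (F, f) ∈ limitReachableSet ↔ 2 * π * ‖F‖ ≤ 1 ∧
      4 * π * |circleMean F + 2 * f| + 4 * π ^ 2 * circleMean (fun x => F x ^ 2) ≤ 1 := by
  refine ⟨fun h => ⟨norm_le_of_mem_limitReachableSet h, ?_⟩,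
    fun h => mem_limitReachableSet_of_le h.1 h.2⟩
  rcases abs_choice (circleMean F + 2 * f) with hc | hc
  · simpa [hc] using signed_le_of_mem_limitReachableSet h (ε := 1) (by simp)
  · simpa only [hc, neg_one_mul] using signed_le_of_mem_limitReachableSet h (ε := -1) (by simp)

/-! ### The Minkowski function -/

/-- The left side is the larger root of `r² - 2br - q`, and the other root is not positive. -/
theorem add_sqrt_le_iff {b q r : ℝ} (hq : 0 ≤ q) (hr : 0 < r) :
    b + √(b ^ 2 + q) ≤ r ↔ 2 * b * r + q ≤ r ^ 2 := by
  constructor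
  · intro h
    have h1 : √(b ^ 2 + q) ≤ r - b := by linarith
    have h2 := (Real.sqrt_le_left (by linarith [Real.sqrt_nonneg (b ^ 2 + q)])).1 h1
    linarith
  · intro h
    have hbr : b ≤ r := by
      by_contra! hlt
      nlinarith
    have := Real.sqrt_le_sqrt (show b ^ 2 + q ≤ (r - b) ^ 2 by linarith)
    rw [Real.sqrt_sq (by linarith)] at this
    linarith

theorem inv_smul_mem_limitReachableSet_iff {F : LInf} {f r : ℝ} (hr : 0 < r) :
    r⁻¹ • (F, f) ∈ limitReachableSet ↔
      2 * π * max ‖F‖ (|circleMean F + 2 * f| +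
        √((circleMean F + 2 * f) ^ 2 + circleMean (fun x => F x ^ 2))) ≤ r := by
  have hπ := Real.two_pi_pos
  rw [Prod.smul_mk, mem_limitReachableSet_iff, norm_smul, LInf.circleMean_smul,
    LInf.circleMean_sq_smul, smul_eq_mul, Real.norm_of_nonneg (inv_pos.2 hr).le,
    show r⁻¹ * circleMean F + 2 * (r⁻¹ * f) = r⁻¹ * (circleMean F + 2 * f) by ring, abs_mul,
    abs_of_pos (inv_pos.2 hr), mul_comm (2 * π) (max _ _), ← le_div_iff₀ hπ, max_le_iff,
    ← sq_abs (circleMean F + 2 * f),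
    add_sqrt_le_iff F.circleMean_sq_nonneg (div_pos hr hπ)]
  refine and_congr ?_ ?_
  · rw [le_div_iff₀ hπ, show 2 * π * (r⁻¹ * ‖F‖) = r⁻¹ * (‖F‖ * (2 * π)) by ring,
      inv_mul_le_iff₀ hr, mul_one]
  · have h4 : 0 < r ^ 2 := by positivity
    have h5 : 0 < 4 * π ^ 2 := by positivity
    rw [← mul_le_mul_iff_right₀ h4, ← mul_le_mul_iff_right₀ h5 (b := 2 * _ * _ + _)]
    have := Real.pi_ne_zero
    refine iff_of_eq ?_
    congr 1
    · field_simp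
    · field_simp
      ring

theorem gauge_limitReachableSet (F : LInf) (f : ℝ) :
    gauge limitReachableSet (F, f) =
      2 * π * max ‖F‖ (|circleMean F + 2 * f| +
        √((circleMean F + 2 * f) ^ 2 + circleMean (fun x => F x ^ 2))) := by
  set M := 2 * π * max ‖F‖ (|circleMean F + 2 * f| +
        √((circleMean F + 2 * f) ^ 2 + circleMean (fun x => F x ^ 2))) with hM
  have hM0 : 0 ≤ M := mul_nonneg Real.two_pi_pos.le ((norm_nonneg F).trans (le_max_left _ _))
  have hset : {r ∈ Set.Ioi (0 : ℝ) | r⁻¹ • (F, f) ∈ limitReachableSet} =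
      Set.Ioi 0 ∩ Set.Ici M := by
    ext r
    exact and_congr_right fun hr => inv_smul_mem_limitReachableSet_iff hr
  rw [gauge_def', hset]
  -- Only positive `r` are admitted, so the infimum is not attained when `M = 0`.
  rcases hM0.eq_or_lt with h0 | hpos
  · rw [← h0, Set.inter_eq_left.2 Set.Ioi_subset_Ici_self, csInf_Ioi]
  · rw [Set.inter_eq_right.2 (Set.Ici_subset_Ioi.2 hpos), csInf_Ici]

/-! ### Supporting functionals -/

theorem eq_zero_of_mul_sub_sq_mul_le {a b δ : ℝ} (hδ : 0 < δ)
    (h : ∀ t, |t| ≤ δ → t * a - t ^ 2 * b ≤ 0) : a = 0 := by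
  have hloc : IsLocalMax (fun t : ℝ => t * a - t ^ 2 * b) 0 := by
    filter_upwards [Metric.ball_mem_nhds (0 : ℝ) hδ] with t ht
    have := h t (by simpa using (Metric.mem_ball.1 ht).le)
    simpa using this
  have hd : HasDerivAt (fun t : ℝ => t * a - t ^ 2 * b) (1 * a - (2 * 0 ^ 1 * 1) * b) 0 :=
    ((hasDerivAt_id (0 : ℝ)).mul_const a).sub (((hasDerivAt_id (0 : ℝ)).pow 2).mul_const b)
  simpa using hloc.hasDerivAt_eq_zero hd

/-- The functional `G ↦ ∫ G g` on `L_∞` given by an integrable function `g`. -/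
noncomputable def LInf.integralFunctional (g : Circle2pi → ℝ) (hg : Integrable g) :
    StrongDual ℝ LInf :=
  LinearMap.mkContinuous
    { toFun := fun G => ∫ x, G x * g x
      map_add' := fun G H => by
        rw [← integral_add (G.integrable_mul hg) (H.integrable_mul hg)]
        refine integral_congr_ae ((Lp.coeFn_add G H).mono fun x hx => ?_)
        simp only [hx, Pi.add_apply, add_mul]
      map_smul' := fun t G => by
        rw [RingHom.id_apply, smul_eq_mul, ← integral_const_mul]
        refine integral_congr_ae ((Lp.coeFn_smul t G).mono fun x hx => ?_)
        simp only [hx, Pi.smul_apply, smul_eq_mul, mul_assoc] }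
    (∫ x, |g x|) fun G => by
      refine le_of_le_of_eq (norm_integral_le_of_norm_le (hg.abs.const_mul ‖G‖) ?_)
        ((integral_const_mul _ _).trans (mul_comm _ _))
      filter_upwards [G.ae_abs_le_norm] with x hx
      rw [Real.norm_eq_abs, abs_mul]
      exact mul_le_mul_of_nonneg_right hx (abs_nonneg _)

theorem LInf.integral_mul_affine (F G : LInf) (a b : ℝ) :
    ∫ x, G x * (a * F x + b) =
      2 * π * (a * circleMean (fun x => F x * G x) + b * circleMean G) := by
  have : ∀ x, G x * (a * F x + b) = a * (F x * G x) + b * G x := fun x => by ring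
  simp only [this]
  rw [integral_add ((F.integrable_mul_coe G).const_mul a) (G.integrable.const_mul b),
    integral_const_mul, integral_const_mul, circleMean, circleMean]
  have := Real.pi_ne_zero
  field_simp

/-! ### First variation and convexity at a smooth boundary point -/

section BoundaryPoint

variable {F : LInf} {f σ : ℝ}

/-- Where the norm constraint is inactive, a functional bounded by `1` on the limit reachable set
and equal to `1` at a boundary point is proportional to the gradient of the active constraint. -/
theorem apply_eq_of_dualPairing_le (hF : 2 * π * ‖F‖ < 1) (hσ : |σ| = 1)
    (hb : 4 * π * (σ * (circleMean F + 2 * f)) + 4 * π ^ 2 * circleMean (fun x => F x ^ 2) = 1)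
    {Φ : StrongDual ℝ LInf} {φ : ℝ}
    (hle : ∀ p ∈ limitReachableSet, dualPairing p (Φ, φ) ≤ 1)
    (h1 : dualPairing (F, f) (Φ, φ) = 1) (G : LInf) :
    Φ G = φ * (π * circleMean G + 2 * π ^ 2 * σ * circleMean (fun x => F x * G x)) := by
  have hσ2 : σ * σ = 1 := by rw [← abs_mul_abs_self, hσ, one_mul]
  have hπ := Real.pi_pos
  set q : ℝ → ℝ := fun t => circleMean (fun x => (F + t • G : LInf) x ^ 2) with hq
  -- Solving the active constraint for the second coordinate gives a curve through `(F, f)` that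
  -- stays on the boundary while `F` moves along `G`.
  set g : ℝ → ℝ := fun t =>
    (σ * (1 - 4 * π ^ 2 * q t) / (4 * π) - (circleMean F + t * circleMean G)) / 2 with hg
  obtain ⟨δ, hδ, hδF⟩ : ∃ δ : ℝ, 0 < δ ∧ ∀ t : ℝ, |t| ≤ δ → 2 * π * ‖F + t • G‖ ≤ 1 := by
    refine ⟨(1 - 2 * π * ‖F‖) / (2 * π * (‖G‖ + 1)), by
      have := norm_nonneg G
      exact div_pos (by linarith) (by positivity), fun t ht => ?_⟩
    rw [le_div_iff₀ (by have := norm_nonneg G; positivity)] at ht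
    have h2 : ‖F + t • G‖ ≤ ‖F‖ + |t| * ‖G‖ := by
      simpa [norm_smul] using norm_add_le F (t • G)
    nlinarith [mul_le_mul_of_nonneg_left h2 Real.two_pi_pos.le, abs_nonneg t]
  have hmem : ∀ t, |t| ≤ δ → (F + t • G, g t) ∈ limitReachableSet := fun t ht => by
    refine mem_limitReachableSet_of_le (hδF t ht) ?_
    have hc : circleMean (F + t • G : LInf) + 2 * g t = σ * ((1 - 4 * π ^ 2 * q t) / (4 * π)) := by
      rw [LInf.circleMean_add, LInf.circleMean_smul, hg]
      ring
    -- This keeps `σ(⟨F + tG⟩ + 2g(t))` nonnegative, so the absolute value in the constraint equals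
    -- the branch with sign `σ`.
    have hqt : 4 * π ^ 2 * q t ≤ 1 := by
      have hs := (F + t • G).circleMean_sq_le
      have hn : (2 * π * ‖F + t • G‖) ^ 2 ≤ 1 := pow_le_one₀ (by positivity) (hδF t ht)
      nlinarith [mul_le_mul_of_nonneg_left hs (sq_nonneg π)]
    rw [hc, abs_mul, hσ, one_mul, abs_of_nonneg (div_nonneg (by linarith) (by positivity)),
      mul_div_cancel₀ _ (by positivity)]
    exact le_of_eq (by ring)
  have hg0 : f = (σ * (1 - 4 * π ^ 2 * circleMean (fun x => F x ^ 2)) / (4 * π)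
      - circleMean F) / 2 := by
    rw [← hb]
    field_simp
    linear_combination -(circleMean F + 2 * f) * hσ2
  have key := eq_zero_of_mul_sub_sq_mul_le
    (a := Φ G - φ * (π * circleMean G + 2 * π ^ 2 * σ * circleMean (fun x => F x * G x)))
    (b := π ^ 2 * φ * σ * circleMean (fun x => G x ^ 2)) hδ fun t ht => by
      have h2 := hle _ (hmem t ht)
      rw [← h1] at h2
      simp only [dualPairing, map_add, map_smul, smul_eq_mul] at h2
      have h3 : 2 * π * g t * φ = 2 * π * f * φ
          - t * (φ * (π * circleMean G + 2 * π ^ 2 * σ * circleMean (fun x => F x * G x)))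
          - t ^ 2 * (π ^ 2 * φ * σ * circleMean (fun x => G x ^ 2)) := by
        simp only [hg, hq, LInf.circleMean_sq_add_smul]
        rw [hg0]
        field_simp
        ring
      rw [h3] at h2
      linarith
  linarith

/-- Taking the direction `G = F` in the gradient formula turns the normalisation into a linear
equation for `φ`. -/
theorem coeff_eq_of_dualPairing_le (hF : 2 * π * ‖F‖ < 1) (hσ : |σ| = 1)
    (hb : 4 * π * (σ * (circleMean F + 2 * f)) + 4 * π ^ 2 * circleMean (fun x => F x ^ 2) = 1)
    {Φ : StrongDual ℝ LInf} {φ : ℝ}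
    (hle : ∀ p ∈ limitReachableSet, dualPairing p (Φ, φ) ≤ 1)
    (h1 : dualPairing (F, f) (Φ, φ) = 1) :
    φ = 4 * σ / (1 + 4 * π ^ 2 * circleMean (fun x => F x ^ 2)) := by
  have hσ2 : σ * σ = 1 := by rw [← abs_mul_abs_self, hσ, one_mul]
  have h2 := apply_eq_of_dualPairing_le hF hσ hb hle h1 F
  have h3 : dualPairing (F, f) (Φ, φ) = Φ F + 2 * π * f * φ := rfl
  have hq := F.circleMean_sq_nonneg
  simp only [← sq] at h2
  rw [h3, h2] at h1
  rw [eq_div_iff (by positivity)]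
  linear_combination 4 * σ * h1 - φ * hb - 8 * π ^ 2 * φ * circleMean (fun x => F x ^ 2) * hσ2

theorem exists_supporting_functional (hσ : |σ| = 1)
    (hb : 4 * π * (σ * (circleMean F + 2 * f)) + 4 * π ^ 2 * circleMean (fun x => F x ^ 2) = 1) :
    ∃ q : StrongDual ℝ LInf × ℝ, dualPairing (F, f) q = 1 ∧
      ∀ p ∈ limitReachableSet, dualPairing p q ≤ 1 := by
  have hσ2 : σ * σ = 1 := by rw [← abs_mul_abs_self, hσ, one_mul]
  have hq := F.circleMean_sq_nonneg
  set Q := circleMean (fun x => F x ^ 2) with hQ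
  have hK : 0 < 1 + 4 * π ^ 2 * Q := by positivity
  set φ : ℝ := 4 * σ / (1 + 4 * π ^ 2 * Q) with hφ
  have hφK : φ * (1 + 4 * π ^ 2 * Q) = 4 * σ := div_mul_cancel₀ _ hK.ne'
  have hi : Integrable fun x => φ * π * σ * F x + φ / 2 :=
    (F.integrable.const_mul _).add (integrable_const _)
  have key : ∀ (G : LInf) (g : ℝ),
      dualPairing (G, g) (LInf.integralFunctional _ hi, φ) * (1 + 4 * π ^ 2 * Q) =
        4 * π * (σ * (circleMean G + 2 * g)) + 8 * π ^ 2 * circleMean (fun x => F x * G x) := by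
    intro G g
    change ((∫ x, G x * (φ * π * σ * F x + φ / 2)) + 2 * π * g * φ) * _ = _
    rw [LInf.integral_mul_affine]
    linear_combination (2 * π * (π * σ * circleMean (fun x => F x * G x) + circleMean G / 2)
      + 2 * π * g) * hφK + 8 * π ^ 2 * circleMean (fun x => F x * G x) * hσ2
  refine ⟨(LInf.integralFunctional _ hi, φ), ?_, fun p hp => ?_⟩
  · have h := key F f
    simp only [← sq] at h
    exact mul_right_cancel₀ hK.ne' (by rw [h]; linarith)
  · obtain ⟨G, g⟩ := p
    refine le_of_mul_le_mul_right ?_ hK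
    rw [key, one_mul]
    have h1 := signed_le_of_mem_limitReachableSet hp hσ
    -- Convexity enters as `2⟨FG⟩ ≤ ⟨F²⟩ + ⟨G²⟩`.
    have h2 := LInf.circleMean_sq_nonneg (F + (-1 : ℝ) • G)
    rw [LInf.circleMean_sq_add_smul] at h2
    nlinarith [mul_nonneg (sq_nonneg π) h2]

end BoundaryPoint

theorem dualPairing_smul (r : ℝ) (p : LInf × ℝ) (q : StrongDual ℝ LInf × ℝ) :
    dualPairing (r • p) q = r * dualPairing p q := by
  simp only [dualPairing, Prod.smul_fst, Prod.smul_snd, map_smul, smul_eq_mul]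
  ring

theorem supportFun_le_one_iff {S : Set (LInf × ℝ)} {q : StrongDual ℝ LInf × ℝ} :
    supportFun S q ≤ 1 ↔ ∀ p ∈ S, dualPairing p q ≤ 1 := by
  simp only [supportFun, iSup_le_iff]
  exact forall₂_congr fun p _ => by exact_mod_cast Iff.rfl

theorem abs_sign_of_ne_zero {c : ℝ} (hc : c ≠ 0) : |Real.sign c| = 1 := by
  rcases Real.sign_apply_eq_of_ne_zero c hc with h | h <;> rw [h] <;> simp

/-! ### Rescaling to the boundary by the Minkowski function -/

section GaugeGtNorm

variable {F : LInf} {f : ℝ}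

theorem gauge_eq_of_norm_lt (h : 2 * π * ‖F‖ < gauge limitReachableSet (F, f)) :
    gauge limitReachableSet (F, f) = 2 * π * (|circleMean F + 2 * f| +
      √((circleMean F + 2 * f) ^ 2 + circleMean (fun x => F x ^ 2))) := by
  rw [gauge_limitReachableSet] at h ⊢
  rw [max_eq_right]
  by_contra! hlt
  rw [max_eq_left hlt.le] at h
  exact lt_irrefl _ h

theorem gauge_pos_of_norm_lt (h : 2 * π * ‖F‖ < gauge limitReachableSet (F, f)) :
    0 < gauge limitReachableSet (F, f) :=
  (mul_nonneg Real.two_pi_pos.le (norm_nonneg F)).trans_lt h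

/-- Otherwise `μ` would be `2π√⟨F²⟩`, which is at most `2π‖F‖`. -/
theorem circleMean_add_two_mul_ne_zero (h : 2 * π * ‖F‖ < gauge limitReachableSet (F, f)) :
    circleMean F + 2 * f ≠ 0 := fun h0 => by
  have hs : √(circleMean (fun x => F x ^ 2)) ≤ ‖F‖ :=
    (Real.sqrt_le_left (norm_nonneg F)).2 F.circleMean_sq_le
  have hg := gauge_eq_of_norm_lt h
  rw [h0, abs_zero, zero_add, zero_pow two_ne_zero, zero_add] at hg
  exact h.not_ge (hg ▸ mul_le_mul_of_nonneg_left hs Real.two_pi_pos.le)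

theorem norm_inv_gauge_smul_lt (h : 2 * π * ‖F‖ < gauge limitReachableSet (F, f)) :
    2 * π * ‖(gauge limitReachableSet (F, f))⁻¹ • F‖ < 1 := by
  have hμ := gauge_pos_of_norm_lt h
  rw [norm_smul, Real.norm_of_nonneg (inv_pos.2 hμ).le, mul_left_comm, inv_mul_lt_iff₀ hμ, mul_one]
  exact h

theorem inv_gauge_smul_boundary (h : 2 * π * ‖F‖ < gauge limitReachableSet (F, f)) :
    4 * π * (Real.sign (circleMean F + 2 * f) *
      (circleMean ((gauge limitReachableSet (F, f))⁻¹ • F : LInf) +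
        2 * ((gauge limitReachableSet (F, f))⁻¹ * f))) +
      4 * π ^ 2 * circleMean (fun x => ((gauge limitReachableSet (F, f))⁻¹ • F : LInf) x ^ 2) =
        1 := by
  have hμ := gauge_pos_of_norm_lt h
  have hg := gauge_eq_of_norm_lt h
  have hq := F.circleMean_sq_nonneg
  rw [LInf.circleMean_smul, LInf.circleMean_sq_smul]
  set μ := gauge limitReachableSet (F, f)
  have hs := Real.sq_sqrt (add_nonneg (sq_nonneg (circleMean F + 2 * f)) hq)
  have hsign : Real.sign (circleMean F + 2 * f) * (circleMean F + 2 * f) =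
      |circleMean F + 2 * f| := by
    rcases lt_trichotomy (circleMean F + 2 * f) 0 with hc | hc | hc
    · rw [Real.sign_of_neg hc, abs_of_neg hc, neg_one_mul]
    · rw [hc, abs_zero, mul_zero]
    · rw [Real.sign_of_pos hc, abs_of_pos hc, one_mul]
  rw [← sq_abs (circleMean F + 2 * f)] at hg hs
  rw [show √(|circleMean F + 2 * f| ^ 2 + circleMean (fun x => F x ^ 2)) =
    μ / (2 * π) - |circleMean F + 2 * f| by rw [hg]; field_simp; ring] at hs
  field_simp at hs ⊢
  linear_combination 4 * π * μ * hsign - hs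

theorem inv_gauge_smul_mem (h : 2 * π * ‖F‖ < gauge limitReachableSet (F, f)) :
    (gauge limitReachableSet (F, f))⁻¹ • (F, f) ∈ limitReachableSet :=
  (inv_smul_mem_limitReachableSet_iff (gauge_pos_of_norm_lt h)).2 (gauge_limitReachableSet F f).ge

theorem supporting_pair_eq (h : 2 * π * ‖F‖ < gauge limitReachableSet (F, f))
    {Φ : StrongDual ℝ LInf} {φ : ℝ}
    (h1 : dualPairing (F, f) (Φ, φ) = gauge limitReachableSet (F, f))
    (h2 : supportFun limitReachableSet (Φ, φ) = 1) :
    φ = 4 * gauge limitReachableSet (F, f) ^ 2 / (gauge limitReachableSet (F, f) ^ 2 +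
        4 * π ^ 2 * circleMean (fun x => F x ^ 2)) * Real.sign (circleMean F + 2 * f) ∧
      ∀ G, Φ G = ∫ x, G x * (π / gauge limitReachableSet (F, f) * |φ| * F x + φ / 2) := by
  have hμ := gauge_pos_of_norm_lt h
  have hσ := abs_sign_of_ne_zero (circleMean_add_two_mul_ne_zero h)
  have hF := norm_inv_gauge_smul_lt h
  have hb := inv_gauge_smul_boundary h
  have hq := F.circleMean_sq_nonneg
  have hle := supportFun_le_one_iff.1 h2.le
  have h3 := dualPairing_smul (gauge limitReachableSet (F, f))⁻¹ (F, f) (Φ, φ)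
  rw [h1, inv_mul_cancel₀ hμ.ne', Prod.smul_mk, smul_eq_mul] at h3
  have hφ := coeff_eq_of_dualPairing_le hF hσ hb hle h3
  have hΦ := apply_eq_of_dualPairing_le hF hσ hb hle h3
  rw [LInf.circleMean_sq_smul] at hφ
  set μ := gauge limitReachableSet (F, f)
  set σ := Real.sign (circleMean F + 2 * f)
  have hσ2 : σ * σ = 1 := by rw [← abs_mul_abs_self, hσ, one_mul]
  have hφ' : φ = 4 * μ ^ 2 / (μ ^ 2 + 4 * π ^ 2 * circleMean (fun x => F x ^ 2)) * σ := by
    rw [hφ]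
    field_simp
  refine ⟨hφ', fun G => ?_⟩
  have habs : |φ| = φ * σ := by
    rw [hφ', abs_mul, hσ, abs_of_nonneg (by positivity), mul_assoc _ σ σ, hσ2]
  rw [hΦ, LInf.circleMean_smul_mul, LInf.integral_mul_affine, habs]
  field_simp
  ring

theorem exists_supporting_pair (h : 2 * π * ‖F‖ < gauge limitReachableSet (F, f)) :
    ∃ q : StrongDual ℝ LInf × ℝ, dualPairing (F, f) q = gauge limitReachableSet (F, f) ∧
      supportFun limitReachableSet q = 1 := by
  obtain ⟨q, hq, hle⟩ := exists_supporting_functional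
    (abs_sign_of_ne_zero (circleMean_add_two_mul_ne_zero h)) (inv_gauge_smul_boundary h)
  refine ⟨q, ?_, le_antisymm (supportFun_le_one_iff.2 hle) ?_⟩
  · have h1 := dualPairing_smul (gauge limitReachableSet (F, f))⁻¹ (F, f) q
    rw [Prod.smul_mk, smul_eq_mul, hq, eq_inv_mul_iff_mul_eq₀ (gauge_pos_of_norm_lt h).ne',
      mul_one] at h1
    exact h1.symm
  -- The supremum is attained at `(F, f)/μ`, which belongs to the set.
  · have h2 := le_iSup₂ (f := fun p (_ : p ∈ limitReachableSet) =>
      ((dualPairing p q : ℝ) : EReal)) _ (inv_gauge_smul_mem h)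
    rw [Prod.smul_mk, smul_eq_mul, hq] at h2
    exact h2

end GaugeGtNorm

theorem mainTheorem1 (F : LInf) (f : ℝ) :
    gauge limitReachableSet (F, f) =
      2 * π * max ‖F‖
        (|circleMean F + 2 * f| +
          √((circleMean F + 2 * f) ^ 2 + circleMean (fun x => F x ^ 2))) ∧
    (2 * π * ‖F‖ < gauge limitReachableSet (F, f) →
      (∃! q : StrongDual ℝ LInf × ℝ,
        dualPairing (F, f) q = gauge limitReachableSet (F, f) ∧
          supportFun limitReachableSet q = 1) ∧
      ∀ (Φ : StrongDual ℝ LInf) (φ μ : ℝ),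
        μ = gauge limitReachableSet (F, f) →
        dualPairing (F, f) (Φ, φ) = μ →
        supportFun limitReachableSet (Φ, φ) = 1 →
          φ = 4 * μ ^ 2 / (μ ^ 2 + 4 * π ^ 2 * circleMean (fun x => F x ^ 2)) *
              Real.sign (circleMean F + 2 * f) ∧
          IsRepresentedBy Φ (fun x => π / μ * |φ| * F x + φ / 2)) := by
  refine ⟨gauge_limitReachableSet F f, fun h => ⟨?_, ?_⟩⟩
  · obtain ⟨⟨Ψ, ψ⟩, hΨ1, hΨ2⟩ := exists_supporting_pair h
    refine ⟨(Ψ, ψ), ⟨hΨ1, hΨ2⟩, ?_⟩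
    rintro ⟨Φ, φ⟩ ⟨hΦ1, hΦ2⟩
    obtain ⟨hψ, hΨ⟩ := supporting_pair_eq h hΨ1 hΨ2
    obtain ⟨hφ, hΦ⟩ := supporting_pair_eq h hΦ1 hΦ2
    have hφψ : φ = ψ := hφ.trans hψ.symm
    exact Prod.ext (ContinuousLinearMap.ext fun G => by rw [hΦ, hΨ, hφψ]) hφψ
  · rintro Φ φ μ rfl h1 h2
    obtain ⟨hφ, hΦ⟩ := supporting_pair_eq h h1 h2
    exact ⟨hφ, (F.integrable.const_mul _).add (integrable_const _), hΦ⟩
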